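/- For a natural number \(n\), let \(G(n,3,1)\) be the graph whose vertices are the 3-element subsets of \(\{1,\dots,n\}\), two of them being adjacent exactly when they have exactly one element in common. Let \(\alpha_n\) be its independence number. For \(0\le l\le\binom n3\), let \(r(l)=r_n(l)\) be the minimum, over all sets \(W\) of exactly \(l\) vertices of \(G(n,3,1)\), of the number of edges of \(G(n,3,1)\) with both ends in \(W\). All asymptotic notation refers to \(n\to\infty\). For a function \(l:\mathbb N\to\mathbb N\) put \(c_n=1-l(n)/\binom n3\) (for \(n\ge 3\)). (1) Let \(l:\mathbb N\to\mathbb N\) satisfy \(l(n)\le\binom n3\) for all \(n\) and \(n=o(l(n))\). Then there is a function \(h:\mathbb N\to\mathbb N\) with \(h(n)\sim\frac{9\,l(n)^2}{2\alpha_n}\) such that \(r(l(n))\le h(n)\) for every \(n\). (2) Let \(l,g:\mathbb N\to\mathbb N\) and let \(C>0\) be a constant such that \(n^2=o(g(n))\) and \(Cn^3\le l(n)\le\binom n3-g(n)\) for all sufficiently large \(n\). Then there is a function \(h:\mathbb N\to\mathbb R\) with \(h(n)=o(1)\) such that for all sufficiently large \(n\) \[ r(l(n))\ \ge\ \frac{n^5}{8}\Bigl(1-2c_n+\frac{c_n^2}{3}(1+h(n))-\frac{10}{n}+\frac{20c_n}{n}-\frac{10c_n^2}{3n}(1+h(n))\Bigr).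 \] (3) Let \(l,g:\mathbb N\to\mathbb N\) and let \(B\) and \(C>0\) be real constants such that \(n=o(g(n))\) and, for all sufficiently large \(n\), \(g(n)\le Bn^2\) and \(Cn^3\le l(n)\le\binom n3-g(n)\). Then there is a function \(h:\mathbb N\to\mathbb R\) with \(h(n)=o(1)\) such that for all sufficiently large \(n\) \[ r(l(n))\ \ge\ \frac{n^5}{8}\Bigl(1-2c_n+\frac{2c_n^2}{9}(1+h(n))-\frac{10}{n}+\frac{20c_n}{n}-\frac{20c_n^2}{9n}(1+h(n))\Bigr). \] (4) Let \(l:\mathbb N\to\mathbb N\) and let \(C\) be a real constant such that \(\binom n3-Cn\le l(n)\le\binom n3\) for every \(n\). Then for every \(n\ge 10\) \[ r(l(n))\ \ge\ \frac{n^5}{8}\Bigl(1-2c_n-\frac{10}{n}+\frac{20c_n}{n}\Bigr). \] -/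

import Mathlib

open Filter Asymptotics

/-- The graph `G(n,3,1)`: its vertices are the 3-element subsets of an `n`-element set, two of them
being adjacent when they have exactly one element in common. -/
def graphG (n : ℕ) : SimpleGraph {s : Finset (Fin n) // s.card = 3} where
  Adj s t := (s.1 ∩ t.1).card = 1
  symm := ⟨fun s t h => by rwa [Finset.inter_comm]⟩
  loopless := ⟨fun s h => by
    rw [Finset.inter_self, s.2] at h
    omega⟩

/-- `α_n`, the independence number of `G(n,3,1)`. -/
noncomputable def alphaG (n : ℕ) : ℕ := (graphG n).indepNum

/-- `r(W)`, the number of (unordered) edges of `G` both of whose ends lie in `W`. -/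
noncomputable def edgesOn {V : Type*} (G : SimpleGraph V) (W : Finset V) : ℕ :=
  (G.induce (W : Set V)).edgeSet.ncard

/-- `r(l)` in `G(n,3,1)`: the minimum of `r(W)` over the vertex sets `W` with exactly `l` elements
(such sets exist precisely when `l ≤ n.choose 3`). -/
noncomputable def minEdges (n l : ℕ) : ℕ :=
  sInf {k | ∃ W : Finset {s : Finset (Fin n) // s.card = 3},
    W.card = l ∧ edgesOn (graphG n) W = k}

/-- `c_n = 1 - l(n) / C(n,3)`. -/
noncomputable def coDensity (l : ℕ → ℕ) (n : ℕ) : ℝ := 1 - (l n : ℝ) / (n.choose 3 : ℝ)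

/-! ### Edge counts in induced subgraphs of a general graph -/

section InducedEdges

variable {V : Type*} (G : SimpleGraph V)

/-! Upper bound: some `W` of size `l` spans at most the average edge density, `e(G) l² / N²` edges
with `N = n.choose 3` (`exists_card_eq_edgesOn_mul_sq_le`). Here `e(G) / N² ≤ 9 / (2n)`, and
`alphaG_le` gives `α_n ≤ n`.

Lower bounds: `G` is regular, so the edges inside `W` number `e(G)(1 - 2c)` plus those inside the
complement `U` (`minEdges_eq_add_edgesOn`). Part 4 drops the last term. Parts 2 and 3 bound it by
Cauchy–Schwarz: the intersection sizes over `U × U` sum to at least `9|U|²/n`, and pairs meeting in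
two or three points account for little of this (`nine_mul_card_sq_le`). The resulting bound is
explicit for `n ≥ 30`, so the error function `h` can be zero. -/

open Classical in
theorem two_mul_edgesOn (W : Finset V) :
    2 * edgesOn G W = ∑ s ∈ W, (W.filter (G.Adj s)).card := by
  have h := (G.induce (W : Set V)).sum_degrees_eq_twice_card_edges
  rw [edgesOn, Set.ncard_eq_toFinset_card', Set.toFinset_card, ← SimpleGraph.edgeFinset_card, ← h,
    ← Finset.sum_coe_sort W]
  refine Finset.sum_congr rfl fun s _ => ?_
  rw [← SimpleGraph.card_neighborFinset_eq_degree]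
  refine Finset.card_bij (fun t _ => t.1) ?_ ?_ ?_
  · intro t ht
    have ht' : G.Adj s t := by simpa using ht
    exact Finset.mem_filter.2 ⟨t.2, ht'⟩
  · intro a _ b _ hab
    exact Subtype.ext hab
  · intro b hb
    obtain ⟨hbW, hb⟩ := Finset.mem_filter.1 hb
    exact ⟨⟨b, hbW⟩, by simpa using hb, rfl⟩

open Classical in
theorem sum_card_filter_adj_comm (A B : Finset V) :
    ∑ s ∈ A, (B.filter (G.Adj s)).card = ∑ t ∈ B, (A.filter (G.Adj t)).card := by
  simp only [Finset.card_filter]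
  rw [Finset.sum_comm]
  simp only [G.adj_comm]

open Classical in
/-- In a regular graph, the edges inside `W` are counted by the edges inside its complement. -/
theorem two_mul_edgesOn_add_degree_mul_card_compl [Fintype V] [DecidableEq V] {d : ℕ}
    (hd : ∀ s, (Finset.univ.filter (G.Adj s)).card = d) (W : Finset V) :
    2 * edgesOn G W + d * Wᶜ.card = d * W.card + 2 * edgesOn G Wᶜ := by
  have split : ∀ s, (W.filter (G.Adj s)).card + (Wᶜ.filter (G.Adj s)).card = d := by
    intro s
    rw [← hd s, ← Finset.card_union_of_disjoint
      (Finset.disjoint_filter_filter disjoint_compl_right), ← Finset.filter_union,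
      Finset.union_compl]
  have h₁ : ∑ s ∈ W, (W.filter (G.Adj s)).card + ∑ s ∈ W, (Wᶜ.filter (G.Adj s)).card
      = d * W.card := by
    rw [← Finset.sum_add_distrib, Finset.sum_congr rfl fun s _ => split s]
    simp [mul_comm]
  have h₂ : ∑ s ∈ Wᶜ, (W.filter (G.Adj s)).card + ∑ s ∈ Wᶜ, (Wᶜ.filter (G.Adj s)).card
      = d * Wᶜ.card := by
    rw [← Finset.sum_add_distrib, Finset.sum_congr rfl fun s _ => split s]
    simp [mul_comm]
  rw [sum_card_filter_adj_comm G W Wᶜ] at h₁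
  rw [two_mul_edgesOn, two_mul_edgesOn]
  omega

open Classical in
theorem edgesOn_erase_add_card_filter (W : Finset V) {v : V} (hv : v ∈ W) :
    edgesOn G (W.erase v) + (W.filter (G.Adj v)).card = edgesOn G W := by
  have hvv : (W.filter (G.Adj v)) = (W.erase v).filter (G.Adj v) := by
    ext t
    simp only [Finset.mem_filter, Finset.mem_erase]
    exact ⟨fun h => ⟨⟨h.2.ne', h.1⟩, h.2⟩, fun h => ⟨h.1.2, h.2⟩⟩
  have h₀ := two_mul_edgesOn G W
  have h₁ := two_mul_edgesOn G (W.erase v)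
  rw [← Finset.add_sum_erase W _ hv] at h₀
  have h₂ : ∀ s ∈ W.erase v, (W.filter (G.Adj s)).card
      = ((W.erase v).filter (G.Adj s)).card + if G.Adj v s then 1 else 0 := by
    intro s _
    conv_lhs => rw [← Finset.insert_erase hv, Finset.filter_insert]
    by_cases h : G.Adj s v
    · simp [h, h.symm]
    · have h' : ¬ G.Adj v s := fun k => h k.symm
      simp [h, h']
  rw [Finset.sum_congr rfl h₂, Finset.sum_add_distrib, ← Finset.card_filter, ← hvv] at h₀
  omega

/-- Deleting vertices of large degree, one finds `k` vertices spanning at most the average number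
of edges. -/
theorem exists_card_eq_edgesOn_mul_sq_le [Fintype V] {k : ℕ} (hk : k ≤ Fintype.card V) :
    ∃ W : Finset V, W.card = k ∧
      edgesOn G W * Fintype.card V ^ 2 ≤ edgesOn G Finset.univ * k ^ 2 := by
  classical
  induction hk using Nat.decreasingInduction with
  | self => exact ⟨Finset.univ, Finset.card_univ, le_rfl⟩
  | of_succ m hm ih =>
    obtain ⟨W, hW, hle⟩ := ih
    have hne : W.Nonempty := Finset.card_pos.1 (by omega)
    obtain ⟨v, hv, hmax⟩ := W.exists_max_image (fun s => (W.filter (G.Adj s)).card) hne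
    refine ⟨W.erase v, by rw [Finset.card_erase_of_mem hv, hW]; rfl, ?_⟩
    have h₁ := edgesOn_erase_add_card_filter G W hv
    have h₂ : 2 * edgesOn G W ≤ (m + 1) * (W.filter (G.Adj v)).card := by
      rw [two_mul_edgesOn, ← hW, ← smul_eq_mul]
      exact Finset.sum_le_card_nsmul _ _ _ hmax
    -- A maximum degree is at least the average, so the edge count shrinks by a factor at most `(m -
    -- 1)/(m + 1) ≤ m²/(m + 1)²`.
    have h₃ : edgesOn G (W.erase v) * (m + 1) ^ 2 ≤ edgesOn G W * m ^ 2 := by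
      zify at h₁ h₂ ⊢
      nlinarith [Nat.cast_nonneg (α := ℤ) (edgesOn G W)]
    refine Nat.le_of_mul_le_mul_right (c := (m + 1) ^ 2) ?_ (by positivity)
    calc edgesOn G (W.erase v) * Fintype.card V ^ 2 * (m + 1) ^ 2
        = edgesOn G (W.erase v) * (m + 1) ^ 2 * Fintype.card V ^ 2 := by ring
      _ ≤ edgesOn G W * m ^ 2 * Fintype.card V ^ 2 := by gcongr
      _ = edgesOn G W * Fintype.card V ^ 2 * m ^ 2 := by ring
      _ ≤ edgesOn G Finset.univ * (m + 1) ^ 2 * m ^ 2 := by gcongr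
      _ = _ := by ring

end InducedEdges

/-! ### Intersections of triples, and explicit bounds for `r(l)` -/

section Triples

variable {n : ℕ}

/-- The number of triples meeting a given triple in exactly `k` elements. -/
theorem card_filter_card_inter_eq (s : {s : Finset (Fin n) // s.card = 3}) {k : ℕ} (hk : k ≤ 3) :
    (Finset.univ.filter fun t : {s : Finset (Fin n) // s.card = 3} => (s.1 ∩ t.1).card = k).card
      = Nat.choose 3 k * (n - 3).choose (3 - k) := by
  have hc : (s.1ᶜ).card = n - 3 := by rw [Finset.card_compl, s.2, Fintype.card_fin]
  have hprod : (s.1.powersetCard k ×ˢ s.1ᶜ.powersetCard (3 - k)).card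
      = Nat.choose 3 k * (n - 3).choose (3 - k) := by
    rw [Finset.card_product, Finset.card_powersetCard, Finset.card_powersetCard, hc, s.2]
  rw [← hprod]
  refine Finset.card_bij (fun t _ => (s.1 ∩ t.1, t.1 \ s.1)) ?_ ?_ ?_
  · intro t ht
    have ht' : (s.1 ∩ t.1).card = k := by simpa using ht
    have h := Finset.card_sdiff_add_card_inter t.1 s.1
    rw [Finset.inter_comm, ht', t.2] at h
    simp only [Finset.mem_product, Finset.mem_powersetCard]
    refine ⟨⟨Finset.inter_subset_left, ht'⟩, fun x hx => ?_, by omega⟩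
    simpa using (Finset.mem_sdiff.1 hx).2
  · intro t _ t' _ h
    obtain ⟨h₁, h₂⟩ := Prod.ext_iff.1 h
    dsimp only at h₁ h₂
    refine Subtype.ext ?_
    rw [← Finset.sdiff_union_inter t.1 s.1, ← Finset.sdiff_union_inter t'.1 s.1,
      Finset.inter_comm t.1, Finset.inter_comm t'.1, h₁, h₂]
  · rintro ⟨a, b⟩ hab
    simp only [Finset.mem_product, Finset.mem_powersetCard] at hab
    obtain ⟨⟨ha, hak⟩, hb, hbk⟩ := hab
    have hdis : Disjoint b s.1 := by
      rw [Finset.disjoint_left]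
      intro x hx
      simpa using hb hx
    have hi : s.1 ∩ (a ∪ b) = a := by
      rw [Finset.inter_union_distrib_left, Finset.inter_eq_right.2 ha,
        Finset.disjoint_iff_inter_eq_empty.1 hdis.symm, Finset.union_empty]
    refine ⟨⟨a ∪ b, ?_⟩, ?_, ?_⟩
    · rw [Finset.card_union_of_disjoint (hdis.symm.mono_left ha)]
      omega
    · simpa [hi] using hak
    · simp only [hi, Prod.mk.injEq, true_and]
      rw [Finset.union_sdiff_distrib, Finset.sdiff_eq_empty_iff_subset.2 ha, Finset.empty_union,
        Finset.sdiff_eq_self_of_disjoint hdis]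

open Classical in
theorem card_filter_graphG_adj (s : {s : Finset (Fin n) // s.card = 3}) :
    (Finset.univ.filter ((graphG n).Adj s)).card = 3 * (n - 3).choose 2 := by
  have h := card_filter_card_inter_eq s (k := 1) (by norm_num)
  simp only [Nat.choose_one_right] at h
  rw [← h]
  congr 1
  ext t
  simp only [Finset.mem_filter, Finset.mem_univ, true_and]
  rfl

/-- Double counting of the `(s, t, v)` with `v ∈ s ∩ t`. -/
theorem sum_card_inter_eq_sum_sq (U : Finset {s : Finset (Fin n) // s.card = 3}) :
    ∑ s ∈ U, ∑ t ∈ U, (s.1 ∩ t.1).card = ∑ v : Fin n, (U.filter fun s => v ∈ s.1).card ^ 2 := by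
  have h : ∀ s t : {s : Finset (Fin n) // s.card = 3}, (s.1 ∩ t.1).card
      = ∑ v : Fin n, (if v ∈ s.1 then 1 else 0) * (if v ∈ t.1 then 1 else 0) := by
    intro s t
    rw [← Finset.filter_univ_mem (s.1 ∩ t.1), Finset.card_filter]
    refine Finset.sum_congr rfl fun v _ => ?_
    by_cases h₁ : v ∈ s.1 <;> by_cases h₂ : v ∈ t.1 <;> simp [h₁, h₂]
  simp only [h]
  rw [Finset.sum_congr rfl fun s _ => Finset.sum_comm, Finset.sum_comm]
  refine Finset.sum_congr rfl fun v _ => ?_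
  rw [Finset.card_filter, sq, Finset.sum_mul_sum]

theorem sum_card_filter_mem (U : Finset {s : Finset (Fin n) // s.card = 3}) :
    ∑ v : Fin n, (U.filter fun s => v ∈ s.1).card = 3 * U.card := by
  simp only [Finset.card_filter]
  rw [Finset.sum_comm]
  have h : ∀ s ∈ U, (∑ v : Fin n, if v ∈ s.1 then 1 else 0) = 3 := by
    intro s _
    rw [← Finset.card_filter, Finset.filter_univ_mem, s.2]
  rw [Finset.sum_congr rfl h]
  simp [mul_comm]

/-- Cauchy–Schwarz on the point degrees of `U`, which sum to `3|U|`. For fixed `s`, non-adjacent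
triples contribute at most `2·3(n - 3) + 3 ≤ 6n`. -/
theorem nine_mul_card_sq_le (U : Finset {s : Finset (Fin n) // s.card = 3}) :
    9 * U.card ^ 2 ≤ n * (2 * edgesOn (graphG n) U + 6 * n * U.card) := by
  classical
  have hcs := sq_sum_le_card_mul_sum_sq (s := (Finset.univ : Finset (Fin n)))
    (f := fun v => (U.filter fun s => v ∈ s.1).card)
  rw [sum_card_filter_mem, ← sum_card_inter_eq_sum_sq, Finset.card_univ, Fintype.card_fin] at hcs
  have hpt : ∀ s ∈ U, ∑ t ∈ U, (s.1 ∩ t.1).card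
      ≤ (U.filter ((graphG n).Adj s)).card + 6 * n := by
    intro s _
    have hn : 3 ≤ n := by simpa [s.2] using Finset.card_le_univ s.1
    have h₂ : (U.filter fun t => (s.1 ∩ t.1).card = 2).card ≤ 3 * (n - 3) := by
      refine (Finset.card_le_card (Finset.filter_subset_filter _ (Finset.subset_univ U))).trans ?_
      rw [card_filter_card_inter_eq s (by norm_num)]
      simp [Nat.choose]
    have h₃ : (U.filter fun t => (s.1 ∩ t.1).card = 3).card ≤ 1 := by
      refine (Finset.card_le_card (Finset.filter_subset_filter _ (Finset.subset_univ U))).trans ?_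
      rw [card_filter_card_inter_eq s (by norm_num)]
      simp
    have hle : ∑ t ∈ U, (s.1 ∩ t.1).card ≤ (U.filter ((graphG n).Adj s)).card
        + 2 * (U.filter fun t => (s.1 ∩ t.1).card = 2).card
        + 3 * (U.filter fun t => (s.1 ∩ t.1).card = 3).card := by
      simp only [Finset.card_filter, Finset.mul_sum]
      rw [← Finset.sum_add_distrib, ← Finset.sum_add_distrib]
      refine Finset.sum_le_sum fun t _ => ?_
      have hlt : (s.1 ∩ t.1).card ≤ 3 := (Finset.card_le_card Finset.inter_subset_left).trans s.2.le
      have hadj : (if (graphG n).Adj s t then 1 else 0) = if (s.1 ∩ t.1).card = 1 then 1 else 0 :=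
        if_congr Iff.rfl rfl rfl
      rw [hadj]
      interval_cases (s.1 ∩ t.1).card <;> simp
    omega
  have hsum := Finset.sum_le_sum hpt
  rw [Finset.sum_add_distrib, ← two_mul_edgesOn, Finset.sum_const, smul_eq_mul] at hsum
  calc 9 * U.card ^ 2 = (3 * U.card) ^ 2 := by ring
    _ ≤ _ := hcs
    _ ≤ _ := Nat.mul_le_mul_left _ (hsum.trans (le_of_eq (by ring)))

/-- The independence number of `G(n,3,1)` is at most `n`: the triples are odd and their pairwise
intersections even, so their indicator vectors are linearly independent over `𝔽₂`. -/
theorem alphaG_le (n : ℕ) : alphaG n ≤ n := by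
  classical
  obtain ⟨S, hS⟩ := (graphG n).exists_isNIndepSet_indepNum
  let f : {s // s ∈ S} → Fin n → ZMod 2 := fun s v => if v ∈ s.1.1 then 1 else 0
  have hdot : ∀ s t, f s ⬝ᵥ f t = ((s.1.1 ∩ t.1.1).card : ZMod 2) := by
    intro s t
    rw [← Finset.filter_univ_mem (s.1.1 ∩ t.1.1), Finset.card_filter, dotProduct, Nat.cast_sum]
    refine Finset.sum_congr rfl fun v _ => ?_
    by_cases h₁ : v ∈ s.1.1 <;> by_cases h₂ : v ∈ t.1.1 <;> simp [f, h₁, h₂]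
  have hself : ∀ s, f s ⬝ᵥ f s = 1 := by
    intro s
    rw [hdot, Finset.inter_self, s.1.2]
    rfl
  have hne : ∀ s t, s ≠ t → f s ⬝ᵥ f t = 0 := by
    intro s t hst
    have hst' : s.1 ≠ t.1 := fun h => hst (Subtype.ext h)
    have h₁ : (s.1.1 ∩ t.1.1).card ≠ 1 := hS.isIndepSet s.2 t.2 hst'
    have hle : (s.1.1 ∩ t.1.1).card ≤ 3 :=
      (Finset.card_le_card Finset.inter_subset_left).trans s.1.2.le
    have h₃ : (s.1.1 ∩ t.1.1).card ≠ 3 := by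
      intro h
      have hs : s.1.1 ∩ t.1.1 = s.1.1 :=
        Finset.eq_of_subset_of_card_le Finset.inter_subset_left (by rw [h, s.1.2])
      have ht : s.1.1 ∩ t.1.1 = t.1.1 :=
        Finset.eq_of_subset_of_card_le Finset.inter_subset_right (by rw [h, t.1.2])
      exact hst' (Subtype.ext (hs.symm.trans ht))
    rw [hdot]
    interval_cases (s.1.1 ∩ t.1.1).card
    · rfl
    · exact absurd rfl h₁
    · rfl
    · exact absurd rfl h₃
  have hli : LinearIndependent (ZMod 2) f := by
    rw [Fintype.linearIndependent_iff]
    intro g hg s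
    have h := congrArg (fun w => w ⬝ᵥ f s) hg
    simp only [sum_dotProduct, smul_dotProduct, zero_dotProduct] at h
    rw [Finset.sum_eq_single s (fun t _ hts => by rw [hne t s hts, smul_zero]) (by simp),
      hself] at h
    simpa using h
  have hcard := hli.fintype_card_le_finrank
  rw [Module.finrank_fin_fun, Fintype.card_coe, hS.card_eq] at hcard
  exact hcard

theorem alphaG_pos (hn : 3 ≤ n) : 0 < alphaG n := by
  obtain ⟨v, -, hv⟩ := Finset.exists_subset_card_eq (s := (Finset.univ : Finset (Fin n))) (n := 3)
    (by rwa [Finset.card_univ, Fintype.card_fin])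
  have hi : (graphG n).IsIndepSet (({⟨v, hv⟩} : Finset {s : Finset (Fin n) // s.card = 3}) :
      Set {s : Finset (Fin n) // s.card = 3}) := by simp
  exact lt_of_lt_of_le (by simp) hi.card_le_indepNum

theorem minEdges_le (W : Finset {s : Finset (Fin n) // s.card = 3}) :
    minEdges n W.card ≤ edgesOn (graphG n) W :=
  Nat.sInf_le ⟨W, rfl, rfl⟩

theorem exists_edgesOn_eq_minEdges {l : ℕ} (hl : l ≤ n.choose 3) :
    ∃ W : Finset {s : Finset (Fin n) // s.card = 3},
      W.card = l ∧ edgesOn (graphG n) W = minEdges n l := by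
  have hcard : Fintype.card {s : Finset (Fin n) // s.card = 3} = n.choose 3 := by
    rw [Fintype.card_finset_len, Fintype.card_fin]
  obtain ⟨W, -, hW⟩ := Finset.exists_subset_card_eq
    (s := (Finset.univ : Finset {s : Finset (Fin n) // s.card = 3})) (n := l)
    (by rwa [Finset.card_univ, hcard])
  exact Nat.sInf_mem
    (s := {k | ∃ W : Finset {s : Finset (Fin n) // s.card = 3},
      W.card = l ∧ edgesOn (graphG n) W = k}) ⟨_, W, hW, rfl⟩

theorem six_mul_choose_three (hn : 3 ≤ n) :
    6 * (n.choose 3 : ℝ) = n * (n - 1) * (n - 2) := by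
  obtain ⟨m, rfl⟩ := Nat.exists_eq_add_of_le' hn
  have h := Nat.descFactorial_eq_factorial_mul_choose (m + 3) 3
  simp only [Nat.descFactorial, Nat.factorial] at h
  have h' : ((m + 3 - 2) * ((m + 3 - 1) * ((m + 3 - 0) * 1)) : ℕ) = (m + 1) * ((m + 2) * (m + 3)) := by
    simp
  rw [h'] at h
  have h'' := congrArg (Nat.cast (R := ℝ)) h
  push_cast at h'' ⊢
  linarith

theorem two_mul_choose_two_sub (hn : 3 ≤ n) :
    2 * ((n - 3).choose 2 : ℝ) = (n - 3) * (n - 4) := by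
  rw [Nat.cast_choose_two, Nat.cast_sub hn]
  push_cast
  ring

theorem minEdges_eq_add_edgesOn {l : ℕ} (hn : 3 ≤ n) (hl : l ≤ n.choose 3) :
    ∃ U : Finset {s : Finset (Fin n) // s.card = 3},
      (U.card : ℝ) = (1 - l / n.choose 3) * n.choose 3 ∧
      (minEdges n l : ℝ) = n * (n - 1) * (n - 2) * (n - 3) * (n - 4) / 8
        * (1 - 2 * (1 - l / n.choose 3)) + edgesOn (graphG n) U := by
  classical
  obtain ⟨W, hW, hmin⟩ := exists_edgesOn_eq_minEdges hl
  have hN : (0 : ℝ) < n.choose 3 := by exact_mod_cast Nat.choose_pos hn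
  have hcompl : (Wᶜ.card : ℝ) = n.choose 3 - l := by
    rw [Finset.card_compl, hW, Fintype.card_finset_len, Fintype.card_fin, Nat.cast_sub hl]
  have hdeg := two_mul_edgesOn_add_degree_mul_card_compl (graphG n) card_filter_graphG_adj W
  rw [hW, hmin] at hdeg
  have hdeg' := congrArg (Nat.cast (R := ℝ)) hdeg
  push_cast at hdeg'
  rw [hcompl] at hdeg'
  have h₂ := two_mul_choose_two_sub hn
  have h₃ := six_mul_choose_three hn
  refine ⟨Wᶜ, by rw [hcompl]; field_simp, ?_⟩
  have hE : (n * (n - 1) * (n - 2) * (n - 3) * (n - 4) / 8 : ℝ)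
      = 3 * (n - 3).choose 2 * n.choose 3 / 2 := by
    linear_combination (-(n - 3) * (n - 4) / 8) * h₃ - (3 * (n.choose 3 : ℝ) / 4) * h₂
  rw [hE]
  have hl' : (n.choose 3 : ℝ) * (1 - 2 * (1 - l / n.choose 3)) = 2 * l - n.choose 3 := by
    field_simp
    ring
  linear_combination hdeg' / 2 - (3 * ((n - 3).choose 2 : ℝ) / 2) * hl'

theorem le_minEdges_of_thirty_le {l : ℕ} (hn : 30 ≤ n) (hl : l ≤ n.choose 3) {c : ℝ}
    (hc : c = 1 - l / n.choose 3) :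
    (n : ℝ) ^ 5 / 8 * (1 - 2 * c + c ^ 2 / 3 - 10 / n + 20 * c / n - 10 * c ^ 2 / (3 * n))
      ≤ minEdges n l := by
  obtain ⟨U, hU, hmin⟩ := minEdges_eq_add_edgesOn (by omega : 3 ≤ n) hl
  rw [← hc] at hU hmin
  have hn' : (30 : ℝ) ≤ n := by exact_mod_cast hn
  have hpos : (0 : ℝ) < n := by linarith
  have hc0 : 0 ≤ c := by
    rw [hc, sub_nonneg]
    exact div_le_one_of_le₀ (by exact_mod_cast hl) (Nat.cast_nonneg _)
  have h₃ := six_mul_choose_three (by omega : 3 ≤ n)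
  have hN : (n.choose 3 : ℝ) = n * (n - 1) * (n - 2) / 6 := by linarith
  have hcs : 9 * (U.card : ℝ) ^ 2 ≤ n * (2 * edgesOn (graphG n) U + 6 * n * U.card) := by
    exact_mod_cast nine_mul_card_sq_le U
  rw [hU, hN] at hcs
  have hU' : (n : ℝ) / 8 * (((n - 1) * (n - 2)) ^ 2 * c ^ 2 - 4 * n * ((n - 1) * (n - 2)) * c)
      ≤ edgesOn (graphG n) U := by
    refine le_of_mul_le_mul_left ?_ hpos
    linarith
  have hpoly : (n : ℝ) ^ 3 * (n - 10) * (1 - 2 * c + c ^ 2 / 3)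
      ≤ (n - 1) * (n - 2) * (n - 3) * (n - 4) * (1 - 2 * c)
        + (((n - 1) * (n - 2)) ^ 2 * c ^ 2 - 4 * n * ((n - 1) * (n - 2)) * c) := by
    generalize (n : ℝ) = x at hn' hpos ⊢
    have hA : x ^ 4 / 2 ≤ 2 / 3 * x ^ 4 - 8 / 3 * x ^ 3 + 13 * x ^ 2 - 12 * x + 4 := by
      nlinarith [pow_pos hpos 3, pow_pos hpos 2, mul_nonneg (pow_pos hpos 3).le (sub_nonneg.2 hn')]
    have hB : 4 * x ^ 3 + 58 * x ^ 2 - 92 * x + 48 ≤ 6 * x ^ 3 := by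
      nlinarith [mul_nonneg (pow_pos hpos 2).le (sub_nonneg.2 hn')]
    have hD : 30 * x ^ 2 ≤ 35 * x ^ 2 - 50 * x + 24 := by nlinarith
    have hA' := mul_le_mul_of_nonneg_right hA (sq_nonneg c)
    have hB' := mul_le_mul_of_nonneg_right hB hc0
    -- The difference is at least `x⁴c²/2 - 6x³c + 30x² = x²(xc - 6)²/2 + 12x²`.
    nlinarith [mul_nonneg (sq_nonneg x) (sq_nonneg (x * c - 6)), sq_nonneg x]
  rw [hmin]
  calc (n : ℝ) ^ 5 / 8 * (1 - 2 * c + c ^ 2 / 3 - 10 / n + 20 * c / n - 10 * c ^ 2 / (3 * n))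
      = n / 8 * (n ^ 3 * (n - 10) * (1 - 2 * c + c ^ 2 / 3)) := by field_simp; ring
    _ ≤ n / 8 * ((n - 1) * (n - 2) * (n - 3) * (n - 4) * (1 - 2 * c)
        + (((n - 1) * (n - 2)) ^ 2 * c ^ 2 - 4 * n * ((n - 1) * (n - 2)) * c)) :=
      mul_le_mul_of_nonneg_left hpoly (by positivity)
    _ ≤ n * (n - 1) * (n - 2) * (n - 3) * (n - 4) / 8 * (1 - 2 * c) + edgesOn (graphG n) U := by
      linarith

theorem le_minEdges_of_ten_le {l : ℕ} (hn : 10 ≤ n) (hl : l ≤ n.choose 3) {c : ℝ}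
    (hc : c = 1 - l / n.choose 3) :
    (n : ℝ) ^ 5 / 8 * (1 - 2 * c - 10 / n + 20 * c / n) ≤ minEdges n l := by
  obtain ⟨U, -, hmin⟩ := minEdges_eq_add_edgesOn (by omega : 3 ≤ n) hl
  rw [← hc] at hmin
  have hn' : (10 : ℝ) ≤ n := by exact_mod_cast hn
  have hpos : (0 : ℝ) < n := by linarith
  have heq : (n : ℝ) ^ 5 / 8 * (1 - 2 * c - 10 / n + 20 * c / n)
      = n ^ 4 / 8 * (n - 10) * (1 - 2 * c) := by field_simp; ring
  rw [heq]
  rcases le_total 0 (1 - 2 * c) with h | h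
  · have hE : (n : ℝ) ^ 4 / 8 * (n - 10) ≤ n * (n - 1) * (n - 2) * (n - 3) * (n - 4) / 8 := by
      have : 0 ≤ (n : ℝ) * (35 * n ^ 2 - 50 * n + 24) := by
        refine mul_nonneg hpos.le ?_
        nlinarith
      linarith
    rw [hmin]
    have := mul_le_mul_of_nonneg_right hE h
    have := Nat.cast_nonneg (α := ℝ) (edgesOn (graphG n) U)
    linarith
  -- For `c ≥ 1/2` the claimed bound is nonpositive, as `n ≥ 10`.
  · refine le_trans (mul_nonpos_of_nonneg_of_nonpos ?_ h) (Nat.cast_nonneg _)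
    exact mul_nonneg (by positivity) (by linarith)

theorem minEdges_le_div_alphaG {l : ℕ} (hl : l ≤ n.choose 3) :
    (minEdges n l : ℝ) ≤ 9 * (l : ℝ) ^ 2 / (2 * alphaG n) := by
  obtain ⟨W, hW, hle⟩ := exists_card_eq_edgesOn_mul_sq_le (graphG n) (k := l)
    (by rwa [Fintype.card_finset_len, Fintype.card_fin])
  have hmin : minEdges n l ≤ edgesOn (graphG n) W := hW ▸ minEdges_le W
  -- If `n < 3` then `l = 0`; a positive `l` forces `n ≥ 3`, so that `α_n > 0`.
  rcases Nat.eq_zero_or_pos l with rfl | hlpos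
  · have hW0 : W = ∅ := Finset.card_eq_zero.1 hW
    have h0 := two_mul_edgesOn (graphG n) W
    have : minEdges n 0 = 0 := by
      rw [hW0, Finset.sum_empty] at h0
      rw [hW0] at hmin
      omega
    simp [this]
  classical
  have hn : 3 ≤ n := by
    by_contra h
    rw [Nat.choose_eq_zero_of_lt (by omega)] at hl
    omega
  have hα := alphaG_pos hn
  have hα' : (0 : ℝ) < alphaG n := by exact_mod_cast hα
  have hαn : (alphaG n : ℝ) ≤ n := by exact_mod_cast alphaG_le n
  have hn' : (3 : ℝ) ≤ n := by exact_mod_cast hn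
  have hpos : (0 : ℝ) < n := by linarith
  have hN : (0 : ℝ) < n.choose 3 := by exact_mod_cast Nat.choose_pos hn
  have htot := two_mul_edgesOn (graphG n) Finset.univ
  rw [Finset.sum_congr rfl fun s _ => card_filter_graphG_adj s, Finset.sum_const, Finset.card_univ,
    Fintype.card_finset_len, Fintype.card_fin, smul_eq_mul] at htot
  rw [Fintype.card_finset_len, Fintype.card_fin] at hle
  have htot' : 2 * (edgesOn (graphG n) Finset.univ : ℝ)
      = n.choose 3 * (3 * (n - 3).choose 2) := by exact_mod_cast htot
  have hle' : (edgesOn (graphG n) W : ℝ) * (n.choose 3 : ℝ) ^ 2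
      ≤ edgesOn (graphG n) Finset.univ * l ^ 2 := by exact_mod_cast hle
  have hmin' : (minEdges n l : ℝ) ≤ edgesOn (graphG n) W := by exact_mod_cast hmin
  have h₂ := two_mul_choose_two_sub hn
  have h₃ := six_mul_choose_three hn
  have hchoose : ((n - 3).choose 2 : ℝ) * n ≤ 3 * n.choose 3 := by
    have : ((n : ℝ) - 3) * (n - 4) * n ≤ n * (n - 1) * (n - 2) := by nlinarith
    linear_combination this / 2 + n * h₂ / 2 - h₃ / 2
  have hW2 : 2 * (edgesOn (graphG n) W : ℝ) * n ≤ 9 * l ^ 2 := by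
    refine le_of_mul_le_mul_right ?_ (pow_pos hN 2)
    calc 2 * (edgesOn (graphG n) W : ℝ) * n * (n.choose 3 : ℝ) ^ 2
        = 2 * n * (edgesOn (graphG n) W * (n.choose 3 : ℝ) ^ 2) := by ring
      _ ≤ 2 * (n : ℝ) * ((edgesOn (graphG n) Finset.univ : ℝ) * (l : ℝ) ^ 2) := by gcongr
      _ = (n.choose 3 : ℝ) * 3 * (l : ℝ) ^ 2 * (((n - 3).choose 2 : ℝ) * n) := by
        linear_combination (n * (l : ℝ) ^ 2) * htot'
      _ ≤ (n.choose 3 : ℝ) * 3 * (l : ℝ) ^ 2 * (3 * (n.choose 3 : ℝ)) := by gcongr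
      _ = 9 * (l : ℝ) ^ 2 * (n.choose 3 : ℝ) ^ 2 := by ring
  rw [le_div_iff₀ (by positivity)]
  calc (minEdges n l : ℝ) * (2 * alphaG n) ≤ edgesOn (graphG n) W * (2 * n) := by gcongr
    _ ≤ _ := by linarith

end Triples

/-! ### Asymptotics and assembly -/

theorem tendsto_sq_div_alphaG_atTop {l : ℕ → ℕ}
    (ho : (fun n : ℕ => (n : ℝ)) =o[atTop] fun n => (l n : ℝ)) :
    Tendsto (fun n => 9 * (l n : ℝ) ^ 2 / (2 * (alphaG n : ℝ))) atTop atTop := by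
  have hl' : Tendsto (fun n => (l n : ℝ)) atTop atTop := by
    refine tendsto_atTop_mono' _ ?_ (tendsto_natCast_atTop_atTop (R := ℝ))
    filter_upwards [ho.bound one_pos] with n hn
    simpa using hn
  refine tendsto_atTop_mono' _ ?_ hl'
  filter_upwards [ho.bound one_pos, eventually_ge_atTop 3] with n hn h3
  rw [one_mul, Real.norm_natCast, Real.norm_natCast] at hn
  have hα := alphaG_pos h3
  have hα' : (0 : ℝ) < alphaG n := by exact_mod_cast hα
  have hαn : (alphaG n : ℝ) ≤ n := by exact_mod_cast alphaG_le n
  rw [le_div_iff₀ (by positivity)]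
  -- Since `α_n ≤ n ≤ l`, the quotient is at least `l`.
  nlinarith [mul_le_mul_of_nonneg_left (hαn.trans hn) (Nat.cast_nonneg (α := ℝ) (l n)),
    sq_nonneg (l n : ℝ)]

theorem isEquivalent_natFloor {f : ℕ → ℝ} (hf : Tendsto f atTop atTop) :
    (fun n => ((⌊f n⌋₊ : ℕ) : ℝ)) ~[atTop] f :=
  isEquivalent_nat_floor.comp_tendsto hf

theorem theorem3 :
    -- Part 1
    (∀ l : ℕ → ℕ, (∀ n, l n ≤ n.choose 3) →
      ((fun n : ℕ => (n : ℝ)) =o[atTop] fun n => (l n : ℝ)) →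
      ∃ h : ℕ → ℕ,
        ((fun n => (h n : ℝ)) ~[atTop] fun n => 9 * (l n : ℝ) ^ 2 / (2 * (alphaG n : ℝ))) ∧
        ∀ n, minEdges n (l n) ≤ h n) ∧
    -- Part 2
    (∀ (l g : ℕ → ℕ) (C : ℝ), 0 < C →
      ((fun n : ℕ => (n : ℝ) ^ 2) =o[atTop] fun n => (g n : ℝ)) →
      (∀ᶠ n : ℕ in atTop, C * (n : ℝ) ^ 3 ≤ (l n : ℝ) ∧
        (l n : ℝ) ≤ (n.choose 3 : ℝ) - (g n : ℝ)) →
      ∃ h : ℕ → ℝ, (h =o[atTop] fun _ => (1 : ℝ)) ∧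
        ∀ᶠ n : ℕ in atTop,
          (n : ℝ) ^ 5 / 8 * (1 - 2 * coDensity l n + coDensity l n ^ 2 / 3 * (1 + h n)
            - 10 / (n : ℝ) + 20 * coDensity l n / (n : ℝ)
            - 10 * coDensity l n ^ 2 / (3 * (n : ℝ)) * (1 + h n))
          ≤ (minEdges n (l n) : ℝ)) ∧
    -- Part 3
    (∀ (l g : ℕ → ℕ) (B C : ℝ), 0 < C →
      ((fun n : ℕ => (n : ℝ)) =o[atTop] fun n => (g n : ℝ)) →
      (∀ᶠ n : ℕ in atTop, (g n : ℝ) ≤ B * (n : ℝ) ^ 2 ∧ C * (n : ℝ) ^ 3 ≤ (l n : ℝ) ∧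
        (l n : ℝ) ≤ (n.choose 3 : ℝ) - (g n : ℝ)) →
      ∃ h : ℕ → ℝ, (h =o[atTop] fun _ => (1 : ℝ)) ∧
        ∀ᶠ n : ℕ in atTop,
          (n : ℝ) ^ 5 / 8 * (1 - 2 * coDensity l n + 2 * coDensity l n ^ 2 / 9 * (1 + h n)
            - 10 / (n : ℝ) + 20 * coDensity l n / (n : ℝ)
            - 20 * coDensity l n ^ 2 / (9 * (n : ℝ)) * (1 + h n))
          ≤ (minEdges n (l n) : ℝ)) ∧
    -- Part 4
    (∀ (l : ℕ → ℕ) (C : ℝ),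
      (∀ n : ℕ, (n.choose 3 : ℝ) - C * (n : ℝ) ≤ (l n : ℝ) ∧ l n ≤ n.choose 3) →
      ∀ n : ℕ, 10 ≤ n →
        (n : ℝ) ^ 5 / 8 * (1 - 2 * coDensity l n - 10 / (n : ℝ) + 20 * coDensity l n / (n : ℝ))
          ≤ (minEdges n (l n) : ℝ)) := by

  refine ⟨fun l hl ho => ?_, fun l g C _ _ hl => ?_, fun l g B C _ _ hl => ?_,
    fun l C hl n hn => le_minEdges_of_ten_le hn (hl n).2 rfl⟩
  -- Rounding down keeps the bound, as `r(l)` is an integer, and keeps the equivalence, as the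
  -- quotient tends to infinity.
  · exact ⟨fun n => ⌊9 * (l n : ℝ) ^ 2 / (2 * (alphaG n : ℝ))⌋₊,
      isEquivalent_natFloor (tendsto_sq_div_alphaG_atTop ho),
      fun n => Nat.le_floor (minEdges_le_div_alphaG (hl n))⟩
  · refine ⟨0, isLittleO_zero _ _, ?_⟩
    filter_upwards [hl, eventually_ge_atTop 30] with n hln hn
    have hle : l n ≤ n.choose 3 := by
      have : (l n : ℝ) ≤ n.choose 3 := hln.2.trans (sub_le_self _ (Nat.cast_nonneg _))
      exact_mod_cast this
    simpa using le_minEdges_of_thirty_le hn hle (c := coDensity l n) rfl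
  · refine ⟨0, isLittleO_zero _ _, ?_⟩
    filter_upwards [hl, eventually_ge_atTop 30] with n hln hn
    have hle : l n ≤ n.choose 3 := by
      have : (l n : ℝ) ≤ n.choose 3 := hln.2.2.trans (sub_le_self _ (Nat.cast_nonneg _))
      exact_mod_cast this
    refine le_trans ?_ (le_minEdges_of_thirty_le hn hle (c := coDensity l n) rfl)
    have hn' : (30 : ℝ) ≤ n := by exact_mod_cast hn
    have hpos : (0 : ℝ) < n := by linarith
    refine mul_le_mul_of_nonneg_left ?_ (by positivity)
    -- This is the surplus from having `1/3` in place of `2/9`.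
    have h : 0 ≤ coDensity l n ^ 2 * (n - 10) / (9 * n) :=
      div_nonneg (mul_nonneg (sq_nonneg _) (by linarith)) (by positivity)
    have heq : coDensity l n ^ 2 * (n - 10) / (9 * n)
        = coDensity l n ^ 2 / 9 - 10 * coDensity l n ^ 2 / (9 * n) := by
      field_simp
    rw [heq] at h
    have h₁ : 10 * coDensity l n ^ 2 / (3 * (n : ℝ))
        = 3 * (10 * coDensity l n ^ 2 / (9 * n)) := by field_simp; ring
    have h₂ : 20 * coDensity l n ^ 2 / (9 * (n : ℝ))
        = 2 * (10 * coDensity l n ^ 2 / (9 * n)) := by field_simp; ring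
    simp only [Pi.zero_apply, add_zero, mul_one]
    rw [h₁, h₂]
    linarith
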